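/- Permutations of length $n$ are written in one-line notation with entries $1,\dots,n$. A \emph{complete Baxter permutation} is a permutation $\pi$ of odd length $N$ such that $\pi(i)$ is even if and only if $i$ is even and such that, whenever $\pi(x)=i$, $\pi(y)=i+1$ and $z$ lies strictly between $x$ and $y$, one has $\pi(z)<i$ if $i$ is odd and $\pi(z)>i+1$ if $i$ is even. For a parity-preserving permutation $\pi$, let $\pi^o$ and $\pi^e$ be the permutations it induces on its odd and even entries, i.e. $\pi(2j-1)=2\pi^o(j)-1$ and $\pi(2j)=2\pi^e(j)$; thus if $\pi$ has length $2n+1$, then $\pi^o$ has length $n+1$ and $\pi^e$ has length $n$. The permutations $\pi^o$ (resp. $\pi^e$) for complete Baxter $\pi$ are the \emph{Baxter} (resp. \emph{anti-Baxter}) permutations, and a Baxter permutation $\beta$ and an anti-Baxter permutation $\sigma$ are \emph{compatible} if $\beta=\pi^o$ and $\sigma=\pi^e$ for some complete Baxter permutation $\pi$. A permutation is \emph{doubly alternating} if it and its inverse both begin with an ascent and have alternating ascents and descents (permutations of length at most $1$ included). A \emph{snow leopard permutation} is an anti-Baxter permutation compatible with a doubly alternating Baxter permutation; every such permutation preserves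 parity. An \emph{even thread} (resp. \emph{odd thread}) is a permutation of the form $\pi^e$ (resp. $\pi^o$) with $\pi$ a snow leopard permutation of odd length, and an even thread $\alpha$ and an odd thread $\beta$ are \emph{entangled} if $\alpha=\pi^e$ and $\beta=\pi^o$ for one and the same snow leopard permutation $\pi$ of odd length. An involution is a permutation $\pi$ with $\pi=\pi^{-1}$; it avoids $3412$ if there are no $a<b<c<d$ with $\pi(c)<\pi(d)<\pi(a)<\pi(b)$. The complement $c(\pi)$ of a permutation $\pi$ of length $n$ is given by $c(\pi)(j)=n+1-\pi(j)$. \textbf{Theorem 5.1.} (i) For every integer $n\ge 1$, the increasing permutation $12\cdots n$ is an odd thread, and the even threads entangled with it are exactly the $3412$-avoiding involutions of length $n-1$. (ii) For every integer $n\ge 0$, the decreasing permutation $n\cdots 21$ is an even thread, and the odd threads entangled with it are exactly the complements of the $3412$-avoiding involutions of length $n+1$. -/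

import Mathlib

namespace SnowLeopard

open Equiv

/-! A permutation of length `n` is an element of `Equiv.Perm (Fin n)`. Positions and entries of
`Fin n` are counted from `0`, while the usual one-line notation counts them from `1`, so an odd
entry (position) of the one-line notation is an even element of `Fin n`, and vice versa. -/

/-- `π` preserves parity and, whenever `z` lies strictly between the position `x` of an entry and
the position `y` of the next larger entry, `π z` is smaller than both if `π x` is odd in one-line
notation, and larger than both if `π x` is even in one-line notation. -/
def IsCompleteBaxter {N : ℕ} (π : Perm (Fin N)) : Prop :=
  Odd N ∧
  (∀ i : Fin N, Even (π i : ℕ) ↔ Even (i : ℕ)) ∧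
  ∀ x y z : Fin N, (π y : ℕ) = (π x : ℕ) + 1 →
    ((x < z ∧ z < y) ∨ (y < z ∧ z < x)) →
      (Even (π x : ℕ) → π z < π x) ∧ (Odd (π x : ℕ) → π y < π z)

/-- `β` is the permutation `π^o` that the parity-preserving permutation `π` induces on its odd
entries: in one-line notation `π (2j - 1) = 2 β(j) - 1` for all `j`. -/
def InducedOnOdd {N m : ℕ} (π : Perm (Fin N)) (β : Perm (Fin m)) : Prop :=
  m = (N + 1) / 2 ∧
  ∀ (i : Fin N) (j : Fin m), (i : ℕ) = 2 * (j : ℕ) → (π i : ℕ) = 2 * (β j : ℕ)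

/-- `α` is the permutation `π^e` that the parity-preserving permutation `π` induces on its even
entries: in one-line notation `π (2j) = 2 α(j)` for all `j`. -/
def InducedOnEven {N m : ℕ} (π : Perm (Fin N)) (α : Perm (Fin m)) : Prop :=
  m = N / 2 ∧
  ∀ (i : Fin N) (j : Fin m), (i : ℕ) = 2 * (j : ℕ) + 1 → (π i : ℕ) = 2 * (α j : ℕ) + 1

/-- (Reduced) Baxter permutations. -/
def IsBaxter {m : ℕ} (β : Perm (Fin m)) : Prop :=
  ∃ (N : ℕ) (π : Perm (Fin N)), IsCompleteBaxter π ∧ InducedOnOdd π β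

def IsAntiBaxter {m : ℕ} (α : Perm (Fin m)) : Prop :=
  ∃ (N : ℕ) (π : Perm (Fin N)), IsCompleteBaxter π ∧ InducedOnEven π α

/-- Compatibility of a Baxter permutation `β` and an anti-Baxter permutation `α`. -/
def Compatible {m k : ℕ} (β : Perm (Fin m)) (α : Perm (Fin k)) : Prop :=
  ∃ (N : ℕ) (π : Perm (Fin N)), IsCompleteBaxter π ∧ InducedOnOdd π β ∧ InducedOnEven π α

/-- Up-down permutations: the first step is an ascent, and ascents and descents alternate. -/
def IsAlternating {n : ℕ} (π : Perm (Fin n)) : Prop :=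
  ∀ i j : Fin n, (j : ℕ) = (i : ℕ) + 1 →
    (Even (i : ℕ) → π i < π j) ∧ (Odd (i : ℕ) → π j < π i)

def IsDoublyAlternating {n : ℕ} (π : Perm (Fin n)) : Prop :=
  IsAlternating π ∧ IsAlternating π⁻¹

/-- Snow leopard permutations: the anti-Baxter permutations which are compatible with a doubly
alternating Baxter permutation. -/
def IsSnowLeopard {n : ℕ} (σ : Perm (Fin n)) : Prop :=
  IsAntiBaxter σ ∧
    ∃ (m : ℕ) (β : Perm (Fin m)), IsBaxter β ∧ IsDoublyAlternating β ∧ Compatible β σ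

def IsEvenThread {k : ℕ} (α : Perm (Fin k)) : Prop :=
  ∃ (N : ℕ) (π : Perm (Fin N)), Odd N ∧ IsSnowLeopard π ∧ InducedOnEven π α

def IsOddThread {l : ℕ} (β : Perm (Fin l)) : Prop :=
  ∃ (N : ℕ) (π : Perm (Fin N)), Odd N ∧ IsSnowLeopard π ∧ InducedOnOdd π β

/-- The even thread `α` and the odd thread `β` are induced by the same snow leopard permutation of
odd length. -/
def Entangled {k l : ℕ} (α : Perm (Fin k)) (β : Perm (Fin l)) : Prop :=
  IsEvenThread α ∧ IsOddThread β ∧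
    ∃ (N : ℕ) (π : Perm (Fin N)),
      Odd N ∧ IsSnowLeopard π ∧ InducedOnEven π α ∧ InducedOnOdd π β

/-- The increasing permutation `1 2 ⋯ n`. -/
def increasing (n : ℕ) : Perm (Fin n) := 1

/-- The decreasing permutation `n ⋯ 2 1`. -/
def decreasing (n : ℕ) : Perm (Fin n) := Fin.revPerm

/-- The complement `c(π)`, with `c(π)(j) = n + 1 - π(j)` in one-line notation. -/
def complement {n : ℕ} (π : Perm (Fin n)) : Perm (Fin n) := π.trans Fin.revPerm

def IsInvolution {n : ℕ} (π : Perm (Fin n)) : Prop := π = π⁻¹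

/-- No four entries of `π`, read from left to right, are in the same relative order as `3412`. -/
def Avoids3412 {n : ℕ} (π : Perm (Fin n)) : Prop :=
  ¬ ∃ a b c d : Fin n, a < b ∧ b < c ∧ c < d ∧ π c < π d ∧ π d < π a ∧ π a < π b

end SnowLeopard

namespace SnowLeopard

open Equiv

/-! Positions and entries are counted from 0. A permutation of positive length is snow leopard
exactly when it preserves parity and is laced (`IsLaced`), a condition free of the Baxter partner
`β`. Necessity (`IsSnowLeopard.preservesParity_and_isLaced`): as `β⁻¹` alternates, the entry `i` of
`σ` sits between the entries `i` and `i + 1` of `β`; the Baxter condition around these cuts gives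
lacing, and alternation of `β` gives parity. Sufficiency (`isSnowLeopard_of_isLaced`): a partner is
built from minima and maxima of neighbouring entries of `σ`.

When one thread is monotone, the positions of its entries are known, and lacing becomes a condition
on the other thread alone: `HasNestedArcs` for the even thread, or for the complement of the odd
one. By `hasNestedArcs_iff` this describes the 3412-avoiding involutions: crossing arcs of an
involution form a 3412, and nesting by itself forces an involution. -/

/-! ### Nested arcs and 3412-avoiding involutions -/

/-- No arc of `α` runs across another one: an entry above (below) the diagonal dominates (is
dominated by) all entries at the positions that it jumps over, its target included. -/
def HasNestedArcs {n : ℕ} (α : Perm (Fin n)) : Prop :=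
  ∀ a t : Fin n, (a < t → t ≤ α a → α t < α a) ∧ (α a ≤ t → t < a → α a < α t)

/-- If `α (α a)` lay strictly between `a` and `α a`, nesting would map the interval from `α (α a)`
to `α a` injectively into itself minus its left end. -/
theorem HasNestedArcs.apply_apply_le {n : ℕ} {α : Perm (Fin n)} (h : HasNestedArcs α) {a : Fin n}
    (ha : a < α a) : α (α a) ≤ a := by
  by_contra! hlt
  have hlow : α (α a) < α a := (h a (α a)).1 ha le_rfl
  have hmaps : Set.MapsTo α (Finset.Ico (α (α a)) (α a)) (Finset.Ioo (α (α a)) (α a)) := by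
    intro t ht
    simp only [Finset.coe_Ico, Set.mem_Ico, Finset.coe_Ioo, Set.mem_Ioo] at ht ⊢
    exact ⟨(h (α a) t).2 ht.1 ht.2, (h a t).1 (hlt.trans_le ht.1) ht.2.le⟩
  have hcard := Finset.card_le_card_of_injOn _ hmaps α.injective.injOn
  simp only [Fin.card_Ico, Fin.card_Ioo] at hcard
  omega

/-- Descent on arc length: following a bad arc backwards, `f ↦ e ↦ a`, nesting gives `a < f < e < α
a`, so `f` starts a shorter bad arc. -/
theorem HasNestedArcs.not_apply_apply_lt {n : ℕ} {α : Perm (Fin n)} (h : HasNestedArcs α) :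
    ∀ (d : ℕ) (a : Fin n), (α a : ℕ) - a = d → a < α a → ¬ α (α a) < a := by
  intro d
  induction d using Nat.strong_induction_on with
  | _ d ih =>
    intro a hd ha hlt
    obtain ⟨e, he⟩ := α.surjective a
    obtain ⟨f, hf⟩ := α.surjective e
    have hea : e ≠ a := by rintro rfl; omega
    have hae : a < e := by
      by_contra! hc
      have := (h e a).1 (by omega) (by omega)
      omega
    have heb : e < α a := by
      by_contra! hc
      have hne : e ≠ α a := by rintro rfl; omega
      have := (h e (α a)).2 (by omega) (by omega)
      omega
    have hfe : f < e := by
      by_contra! hc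
      have hne : f ≠ e := by rintro rfl; omega
      have := (h f e).2 (by omega) (by omega)
      omega
    have haf : a < f := by
      by_contra! hc
      have hne : f ≠ a := by rintro rfl; omega
      have := (h f a).1 (by omega) (by omega)
      omega
    exact ih _ (by omega) f rfl (by omega) (by rw [hf, he]; exact haf)

theorem HasNestedArcs.isInvolution {n : ℕ} {α : Perm (Fin n)} (h : HasNestedArcs α) :
    IsInvolution α := by
  have hexc : ∀ a, a < α a → α (α a) = a := fun a ha =>
    le_antisymm (h.apply_apply_le ha) (not_lt.1 (h.not_apply_apply_lt _ a rfl ha))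
  have hinv : ∀ a, α (α a) = a := by
    intro a
    rcases lt_trichotomy a (α a) with ha | ha | ha
    · exact hexc a ha
    · rw [← ha, ← ha]
    · obtain ⟨e, he⟩ := α.surjective a
      rcases lt_trichotomy e a with hea | rfl | hea
      · have := hexc e (by omega)
        rw [he] at this
        rw [this, he]
      · omega
      · have := (h e a).2 (by omega) hea
        omega
  exact eq_inv_of_mul_eq_one_left (Equiv.ext hinv)

theorem HasNestedArcs.avoids3412 {n : ℕ} {α : Perm (Fin n)} (h : HasNestedArcs α) :
    Avoids3412 α := by
  rintro ⟨a, b, c, d, hab, hbc, hcd, h1, h2, h3⟩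
  have hb := (h a b).1 hab
  have hc := (h d c).2
  omega

theorem hasNestedArcs_iff {n : ℕ} {α : Perm (Fin n)} :
    HasNestedArcs α ↔ IsInvolution α ∧ Avoids3412 α := by
  refine ⟨fun h => ⟨h.isInvolution, h.avoids3412⟩, ?_⟩
  rintro ⟨hinv, hav⟩ a t
  have hα : ∀ x, α (α x) = x := fun x =>
    DFunLike.congr_fun (mul_eq_one_iff_eq_inv.2 hinv) x
  constructor
  · intro h1 h2
    by_contra! hc
    have hne : t ≠ α a := by rintro rfl; rw [hα] at hc; omega
    have hne' : α a ≠ α t := fun h => by have := α.injective h; omega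
    -- Crossing arcs: the positions `a < t < α a < α t` carry the entries `α a, α t, a, t`, a 3412.
    exact hav ⟨a, t, α a, α t, h1, by omega, by omega, by rwa [hα, hα], by rw [hα]; omega, by omega⟩
  · intro h1 h2
    by_contra! hc
    have hne : t ≠ α a := by rintro rfl; rw [hα] at hc; omega
    have hne' : α a ≠ α t := fun h => by have := α.injective h; omega
    exact hav ⟨α t, α a, t, a, by omega, by omega, h2, by omega, by rw [hα]; omega,
      by rw [hα, hα]; omega⟩

/-! ### Interleaving and parity -/

/-- The permutation of length `2 * n + 1` that induces `β` on its odd and `α` on its even entries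
(in one-line notation). -/
def interleave {n : ℕ} (β : Perm (Fin (n + 1))) (α : Perm (Fin n)) : Perm (Fin (2 * n + 1)) where
  toFun i := if h : (i : ℕ) % 2 = 0 then ⟨2 * β ⟨i / 2, by omega⟩, by omega⟩
    else ⟨2 * α ⟨i / 2, by omega⟩ + 1, by omega⟩
  invFun i := if h : (i : ℕ) % 2 = 0 then ⟨2 * β⁻¹ ⟨i / 2, by omega⟩, by omega⟩
    else ⟨2 * α⁻¹ ⟨i / 2, by omega⟩ + 1, by omega⟩
  left_inv i := by
    by_cases h : (i : ℕ) % 2 = 0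
    · ext; simp [h]; omega
    · ext; simp [h, Nat.mul_add_div]; omega
  right_inv i := by
    by_cases h : (i : ℕ) % 2 = 0
    · ext; simp [h]; omega
    · ext; simp [h, Nat.mul_add_div]; omega

/-- The position of the `j`-th odd entry in one-line notation. -/
def oddPos {n : ℕ} (j : Fin (n + 1)) : Fin (2 * n + 1) := ⟨2 * j, by omega⟩

/-- The position of the `j`-th even entry in one-line notation. -/
def evenPos {n : ℕ} (j : Fin n) : Fin (2 * n + 1) := ⟨2 * j + 1, by omega⟩

@[simp] theorem val_oddPos {n : ℕ} (j : Fin (n + 1)) : (oddPos j : ℕ) = 2 * j := rfl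

@[simp] theorem val_evenPos {n : ℕ} (j : Fin n) : (evenPos j : ℕ) = 2 * j + 1 := rfl

theorem exists_oddPos_or_evenPos {n : ℕ} (x : Fin (2 * n + 1)) :
    (∃ j, x = oddPos j) ∨ ∃ j, x = evenPos j := by
  rcases Nat.mod_two_eq_zero_or_one x with h | h
  · exact .inl ⟨⟨x / 2, by omega⟩, Fin.ext (by simp; omega)⟩
  · exact .inr ⟨⟨x / 2, by omega⟩, Fin.ext (by simp; omega)⟩

theorem inducedOnOdd_interleave {n : ℕ} (β : Perm (Fin (n + 1))) (α : Perm (Fin n)) :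
    InducedOnOdd (interleave β α) β := by
  refine ⟨by omega, fun i j hij => ?_⟩
  simp [interleave, hij]

theorem inducedOnEven_interleave {n : ℕ} (β : Perm (Fin (n + 1))) (α : Perm (Fin n)) :
    InducedOnEven (interleave β α) α := by
  refine ⟨by omega, fun i j hij => ?_⟩
  simp [interleave, hij, Nat.mul_add_div]

theorem InducedOnOdd.val_oddPos {n : ℕ} {π : Perm (Fin (2 * n + 1))} {β : Perm (Fin (n + 1))}
    (h : InducedOnOdd π β) (j : Fin (n + 1)) : (π (oddPos j) : ℕ) = 2 * β j := h.2 _ j rfl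

theorem InducedOnEven.val_evenPos {n : ℕ} {π : Perm (Fin (2 * n + 1))} {α : Perm (Fin n)}
    (h : InducedOnEven π α) (j : Fin n) : (π (evenPos j) : ℕ) = 2 * α j + 1 := h.2 _ j rfl

def PreservesParity {N : ℕ} (σ : Perm (Fin N)) : Prop := ∀ i, (σ i : ℕ) % 2 = (i : ℕ) % 2

theorem preservesParity_of_induced {n : ℕ} {π : Perm (Fin (2 * n + 1))} {β : Perm (Fin (n + 1))}
    {α : Perm (Fin n)} (hβ : InducedOnOdd π β) (hα : InducedOnEven π α) : PreservesParity π := by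
  intro i
  obtain ⟨j, rfl⟩ | ⟨j, rfl⟩ := exists_oddPos_or_evenPos i
  · rw [hβ.val_oddPos, SnowLeopard.val_oddPos]; omega
  · rw [hα.val_evenPos, SnowLeopard.val_evenPos]; omega

/-! ### Laced permutations with a monotone thread -/

/-- The entries placed between the consecutive entries `σ x` and `σ y = σ x + 1` are all larger or
all smaller than these, according to the order of `x` and `y` and the parity of `σ x`. -/
def IsLaced {N : ℕ} (σ : Perm (Fin N)) : Prop :=
  ∀ x y z : Fin N, (σ y : ℕ) = σ x + 1 →
    (x < z → z < y → ((σ x : ℕ) % 2 = 0 → σ y < σ z) ∧ ((σ x : ℕ) % 2 = 1 → σ z < σ x)) ∧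
    (y < z → z < x → ((σ x : ℕ) % 2 = 0 → σ z < σ x) ∧ ((σ x : ℕ) % 2 = 1 → σ y < σ z))


/-- Even entries are fixed points, so the arc of `a` joins the entry `2 * α a + 1` to its successor
if it goes up and to its predecessor if it goes down. -/
theorem IsLaced.hasNestedArcs_of_increasing {k : ℕ} {σ : Perm (Fin (2 * k + 1))} (h : IsLaced σ)
    {α : Perm (Fin k)} (hβ : InducedOnOdd σ (increasing (k + 1))) (hα : InducedOnEven σ α) :
    HasNestedArcs α := by
  have hσo (j : Fin (k + 1)) : (σ (oddPos j) : ℕ) = 2 * j := hβ.val_oddPos j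
  have hσe := hα.val_evenPos
  intro a t
  have ha := hσe a
  have ht := hσe t
  constructor
  · intro h1 h2
    have hy := hσo (α a).succ
    have := (h (evenPos a) (oddPos (α a).succ) (evenPos t) (by simp_all; omega)).1
    simp only [Fin.lt_def, val_oddPos, val_evenPos, Fin.val_succ] at *
    omega
  · intro h1 h2
    have hx := hσo (α a).castSucc
    have := (h (oddPos (α a).castSucc) (evenPos a) (evenPos t) (by simp_all)).1
    simp only [Fin.lt_def, Fin.le_def, val_oddPos, val_evenPos, Fin.val_castSucc] at *
    omega

theorem HasNestedArcs.isLaced_increasing {k : ℕ} {σ : Perm (Fin (2 * k + 1))}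
    {α : Perm (Fin k)} (hnest : HasNestedArcs α) (hβ : InducedOnOdd σ (increasing (k + 1)))
    (hα : InducedOnEven σ α) : IsLaced σ := by
  have hσo (j : Fin (k + 1)) : (σ (oddPos j) : ℕ) = 2 * j := hβ.val_oddPos j
  have hσe := hα.val_evenPos
  intro x y z hxy
  obtain ⟨a, rfl⟩ | ⟨a, rfl⟩ := exists_oddPos_or_evenPos x <;>
  obtain ⟨b, rfl⟩ | ⟨b, rfl⟩ := exists_oddPos_or_evenPos y <;>
  obtain ⟨c, rfl⟩ | ⟨c, rfl⟩ := exists_oddPos_or_evenPos z <;>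
  simp only [Fin.lt_def, val_oddPos, val_evenPos, hσo, hσe] at * <;>
  first
  | omega
  | (have := hnest a c; simp only [Fin.lt_def, Fin.le_def] at this; omega)
  | (have := hnest b c; simp only [Fin.lt_def, Fin.le_def] at this; omega)

theorem val_decreasing_apply {k : ℕ} (j : Fin k) : (decreasing k j : ℕ) = k - (j + 1) := by
  simp [decreasing]

theorem val_complement_apply {k : ℕ} (ρ : Perm (Fin (k + 1))) (j : Fin (k + 1)) :
    (complement ρ j : ℕ) = k - ρ j := by
  simp [complement]

theorem complement_complement {k : ℕ} (ρ : Perm (Fin k)) : complement (complement ρ) = ρ := by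
  ext; simp [complement]

/-- The entry `2 * (k - ρ a)` has its predecessor at position `2 * ρ a + 1` and its successor at `2
* ρ a - 1`, so lacing again speaks of the arc of `a`. -/
theorem IsLaced.hasNestedArcs_of_decreasing {k : ℕ} {σ : Perm (Fin (2 * k + 1))} (h : IsLaced σ)
    {ρ : Perm (Fin (k + 1))} (hβ : InducedOnOdd σ (complement ρ))
    (hα : InducedOnEven σ (decreasing k)) : HasNestedArcs ρ := by
  have hσo (j : Fin (k + 1)) : (σ (oddPos j) : ℕ) = 2 * (k - ρ j) := by
    rw [hβ.val_oddPos, val_complement_apply]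
  have hσe (j : Fin k) : (σ (evenPos j) : ℕ) = 2 * (k - (j + 1)) + 1 := by
    rw [hα.val_evenPos, val_decreasing_apply]
  intro a t
  have ha := hσo a
  have ht := hσo t
  have hne : (ρ a : ℕ) = ρ t → (a : ℕ) = t := fun e => congrArg _ (ρ.injective (Fin.ext e))
  constructor
  · intro h1 h2
    -- If `ρ a = k`, the entry of `σ` is 0 and has no predecessor, but `k` dominates everything
    -- anyway.
    rcases eq_or_ne (ρ a : ℕ) k with hk | hk
    · omega
    have hx := hσe ⟨ρ a, by omega⟩
    have := (h (evenPos ⟨ρ a, by omega⟩) (oddPos a) (oddPos t) (by simp_all; omega)).2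
    simp only [Fin.lt_def, Fin.le_def, val_oddPos, val_evenPos] at *
    omega
  · intro h1 h2
    rcases Nat.eq_zero_or_pos (ρ a : ℕ) with hk | hk
    · omega
    have hx := hσe ⟨ρ a - 1, by omega⟩
    have := (h (oddPos a) (evenPos ⟨ρ a - 1, by omega⟩) (oddPos t) (by simp_all; omega)).2
    simp only [Fin.lt_def, Fin.le_def, val_oddPos, val_evenPos] at *
    omega

theorem HasNestedArcs.isLaced_decreasing {k : ℕ} {σ : Perm (Fin (2 * k + 1))}
    {ρ : Perm (Fin (k + 1))} (hnest : HasNestedArcs ρ) (hβ : InducedOnOdd σ (complement ρ))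
    (hα : InducedOnEven σ (decreasing k)) : IsLaced σ := by
  have hσo (j : Fin (k + 1)) : (σ (oddPos j) : ℕ) = 2 * (k - ρ j) := by
    rw [hβ.val_oddPos, val_complement_apply]
  have hσe (j : Fin k) : (σ (evenPos j) : ℕ) = 2 * (k - (j + 1)) + 1 := by
    rw [hα.val_evenPos, val_decreasing_apply]
  intro x y z hxy
  obtain ⟨a, rfl⟩ | ⟨a, rfl⟩ := exists_oddPos_or_evenPos x <;>
  obtain ⟨b, rfl⟩ | ⟨b, rfl⟩ := exists_oddPos_or_evenPos y <;>
  obtain ⟨c, rfl⟩ | ⟨c, rfl⟩ := exists_oddPos_or_evenPos z <;>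
  simp only [Fin.lt_def, val_oddPos, val_evenPos, hσo, hσe] at * <;>
  first
  | omega
  | (have := hnest a c; simp only [Fin.lt_def, Fin.le_def] at this; omega)
  | (have := hnest b c; simp only [Fin.lt_def, Fin.le_def] at this; omega)


/-! ### Snow leopard permutations are laced and preserve parity -/

section Necessity

variable {n : ℕ} {π : Perm (Fin (2 * n + 1))} {β : Perm (Fin (n + 1))} {σ : Perm (Fin n)}

/-- Between the entry `i` of `β` and the entry `i` of `σ`, all entries of `β` and `σ` are
smaller. -/
theorem IsCompleteBaxter.below (h : IsCompleteBaxter π) (hβ : InducedOnOdd π β)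
    (hσ : InducedOnEven π σ) {b : Fin (n + 1)} {p : Fin n} (hbp : (β b : ℕ) = σ p) :
    (∀ c : Fin (n + 1), ((b < c ∧ c ≤ p.castSucc) ∨ (p.castSucc < c ∧ c < b)) → β c < β b) ∧
    ∀ c : Fin n, ((b ≤ c.castSucc ∧ c < p) ∨ (p < c ∧ c.castSucc < b)) → σ c < σ p := by
  have hb := hβ.val_oddPos b
  have hp := hσ.val_evenPos p
  constructor
  · intro c hc
    have hz := hβ.val_oddPos c
    have := (h.2.2 (oddPos b) (evenPos p) (oddPos c) (by omega) (by
      simp only [Fin.lt_def, Fin.le_def, val_oddPos, val_evenPos, Fin.val_castSucc] at *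
      omega)).1 (by rw [hb]; simp)
    simp only [Fin.lt_def] at *
    omega
  · intro c hc
    have hz := hσ.val_evenPos c
    have := (h.2.2 (oddPos b) (evenPos p) (evenPos c) (by omega) (by
      simp only [Fin.lt_def, Fin.le_def, val_oddPos, val_evenPos, Fin.val_castSucc] at *
      omega)).1 (by rw [hb]; simp)
    simp only [Fin.lt_def] at *
    omega

/-- Between the entry `i` of `σ` and the entry `i + 1` of `β`, all entries of `β` and `σ` are
larger. -/
theorem IsCompleteBaxter.above (h : IsCompleteBaxter π) (hβ : InducedOnOdd π β)
    (hσ : InducedOnEven π σ) {b : Fin (n + 1)} {p : Fin n} (hbp : (β b : ℕ) = σ p + 1) :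
    (∀ c : Fin (n + 1), ((b < c ∧ c ≤ p.castSucc) ∨ (p.castSucc < c ∧ c < b)) → β b < β c) ∧
    ∀ c : Fin n, ((b ≤ c.castSucc ∧ c < p) ∨ (p < c ∧ c.castSucc < b)) → σ p < σ c := by
  have hb := hβ.val_oddPos b
  have hp := hσ.val_evenPos p
  constructor
  · intro c hc
    have hz := hβ.val_oddPos c
    have := (h.2.2 (evenPos p) (oddPos b) (oddPos c) (by omega) (by
      simp only [Fin.lt_def, Fin.le_def, val_oddPos, val_evenPos, Fin.val_castSucc] at *
      omega)).2 (by rw [hp]; simp)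
    simp only [Fin.lt_def] at *
    omega
  · intro c hc
    have hz := hσ.val_evenPos c
    have := (h.2.2 (evenPos p) (oddPos b) (evenPos c) (by omega) (by
      simp only [Fin.lt_def, Fin.le_def, val_oddPos, val_evenPos, Fin.val_castSucc] at *
      omega)).2 (by rw [hp]; simp)
    simp only [Fin.lt_def] at *
    omega

theorem IsAlternating.val_inv_lt {m : ℕ} {β : Perm (Fin m)} (h : IsAlternating β⁻¹) {b c : Fin m}
    (hbc : (β c : ℕ) = β b + 1) :
    ((β b : ℕ) % 2 = 0 → b < c) ∧ ((β b : ℕ) % 2 = 1 → c < b) := by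
  simpa [Nat.even_iff, Nat.odd_iff] using h (β b) (β c) hbc

/-- The entry `i` of `σ` is placed between the entries `i` and `i + 1` of `β`. -/
theorem IsCompleteBaxter.cut (h : IsCompleteBaxter π) (hβ : InducedOnOdd π β)
    (hσ : InducedOnEven π σ) (halt : IsAlternating β⁻¹) {b c : Fin (n + 1)} {p : Fin n}
    (hb : (β b : ℕ) = σ p) (hc : (β c : ℕ) = σ p + 1) :
    ((σ p : ℕ) % 2 = 0 → b ≤ p.castSucc ∧ p.castSucc < c) ∧
    ((σ p : ℕ) % 2 = 1 → c ≤ p.castSucc ∧ p.castSucc < b) := by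
  have hbc := halt.val_inv_lt (b := b) (c := c) (by omega)
  -- `c` is not between `b` and `p`, where entries of `β` are below `β b`; nor is `b` between `c`
  -- and `p`, where they are above `β c`.
  have h1 := (h.below hβ hσ hb).1 c
  have h2 := (h.above hβ hσ hc).1 b
  simp only [Fin.lt_def, Fin.le_def, Fin.val_castSucc] at *
  omega

theorem exists_val_eq {m : ℕ} (β : Perm (Fin m)) {i : ℕ} (hi : i < m) :
    ∃ b, (β b : ℕ) = i := ⟨β⁻¹ ⟨i, hi⟩, by simp⟩

/-- On the side of `b`, the entry of `β` next to the cut at `p` is at most `σ p`; on the side of `c`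
it exceeds `σ p`. So the parity of `σ p` decides whether `β` ascends or descends at `p`, and
alternation ties this to the parity of `p`. -/
theorem IsCompleteBaxter.preservesParity (h : IsCompleteBaxter π) (hβ : InducedOnOdd π β)
    (hσ : InducedOnEven π σ) (halt : IsDoublyAlternating β) : PreservesParity σ := by
  intro p
  obtain ⟨b, hb⟩ := exists_val_eq β (i := σ p) (by omega)
  obtain ⟨c, hc⟩ := exists_val_eq β (i := σ p + 1) (by omega)
  have hcut := h.cut hβ hσ halt.2 hb hc
  have h1 := (h.below hβ hσ hb).1
  have h2 := (h.above hβ hσ hc).1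
  have h3 := halt.1 p.castSucc p.succ (by simp)
  have b0 := h1 p.castSucc
  have b1 := h1 p.succ
  have c0 := h2 p.castSucc
  have c1 := h2 p.succ
  have e1 : (b : ℕ) = p → β b = β p.castSucc := fun e => congrArg β (Fin.ext e)
  have e2 : (b : ℕ) = p + 1 → β b = β p.succ := fun e => congrArg β (Fin.ext e)
  have e3 : (c : ℕ) = p → β c = β p.castSucc := fun e => congrArg β (Fin.ext e)
  have e4 : (c : ℕ) = p + 1 → β c = β p.succ := fun e => congrArg β (Fin.ext e)
  simp only [Fin.lt_def, Fin.le_def, Fin.val_castSucc, Fin.val_succ, Nat.even_iff,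
    Nat.odd_iff, Fin.ext_iff] at *
  rcases Nat.mod_two_eq_zero_or_one (σ p) with hp | hp
  · have := hcut.1 hp
    omega
  · have := hcut.2 hp
    omega

/-- The common entry `σ p + 1` of the two cuts, at `c`, has `p` and `q` on the same side. Any `z`
between them thus lies between `c` and the farther one, where `above` (for `p`) or `below` (for `q`)
applies. -/
theorem IsCompleteBaxter.isLaced (h : IsCompleteBaxter π) (hβ : InducedOnOdd π β)
    (hσ : InducedOnEven π σ) (halt : IsAlternating β⁻¹) : IsLaced σ := by
  intro p q z hpq
  obtain ⟨b, hb⟩ := exists_val_eq β (i := σ p) (by omega)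
  obtain ⟨c, hc⟩ := exists_val_eq β (i := σ p + 1) (by omega)
  obtain ⟨d, hd⟩ := exists_val_eq β (i := σ q + 1) (by omega)
  have hcut := h.cut hβ hσ halt hb hc
  have hcut' := h.cut hβ hσ halt (hc.trans hpq.symm) hd
  have h1 := (h.above hβ hσ hc).2 z
  have h2 := (h.below hβ hσ (hc.trans hpq.symm)).2 z
  have hzp : (σ z : ℕ) = σ p → (z : ℕ) = p := fun e => congrArg _ (σ.injective (Fin.ext e))
  have hzq : (σ z : ℕ) = σ q → (z : ℕ) = q := fun e => congrArg _ (σ.injective (Fin.ext e))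
  simp only [Fin.lt_def, Fin.le_def, Fin.val_castSucc] at *
  refine ⟨fun h3 h4 => ⟨fun h5 => ?_, fun h5 => ?_⟩, fun h3 h4 => ⟨fun h5 => ?_, fun h5 => ?_⟩⟩ <;>
  omega

end Necessity

theorem IsSnowLeopard.preservesParity_and_isLaced {n : ℕ} {σ : Perm (Fin n)}
    (h : IsSnowLeopard σ) : PreservesParity σ ∧ IsLaced σ := by
  obtain ⟨-, m, β, -, halt, N, π, hπ, hβ, hσ⟩ := h
  obtain ⟨r, rfl⟩ := hπ.1
  obtain rfl : m = r + 1 := by have := hβ.1; omega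
  obtain rfl : n = r := by have := hσ.1; omega
  exact ⟨hπ.preservesParity hβ hσ halt, hπ.isLaced hβ hσ halt.2⟩


/-! ### Building a doubly alternating partner of a laced permutation -/

/-- `f j` is the smaller of the entries of `σ` at the positions `j - 1` and `j` if `j` is even, and
one more than the larger of them if `j` is odd. -/
structure IsCompanion {n : ℕ} (σ : Perm (Fin n)) (f : Fin (n + 1) → ℕ) : Prop where
  le {j : Fin (n + 1)} {r : Fin n} :
    (j : ℕ) % 2 = 0 → ((r : ℕ) = j ∨ (r : ℕ) + 1 = j) → f j ≤ σ r
  lt {j : Fin (n + 1)} {r : Fin n} :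
    (j : ℕ) % 2 = 1 → ((r : ℕ) = j ∨ (r : ℕ) + 1 = j) → σ r < f j
  attained (j : Fin (n + 1)) : ∃ p : Fin n, ((p : ℕ) = j ∨ (p : ℕ) + 1 = j) ∧
    ((j : ℕ) % 2 = 0 → f j = σ p) ∧ ((j : ℕ) % 2 = 1 → f j = σ p + 1)

/-- Positivity of `n` ensures that every `j` has a neighbouring position in `σ`. -/
theorem exists_isCompanion {n : ℕ} (hn : 0 < n) (σ : Perm (Fin n)) : ∃ f, IsCompanion σ f := by
  have key : ∀ j : Fin (n + 1), ∃ v : ℕ, ∃ p : Fin n, ((p : ℕ) = j ∨ (p : ℕ) + 1 = j) ∧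
      ((j : ℕ) % 2 = 0 → v = σ p) ∧ ((j : ℕ) % 2 = 1 → v = σ p + 1) ∧
      ∀ r : Fin n, ((r : ℕ) = j ∨ (r : ℕ) + 1 = j) →
        ((j : ℕ) % 2 = 0 → v ≤ σ r) ∧ ((j : ℕ) % 2 = 1 → (σ r : ℕ) < v) := by
    intro j
    let S : Finset (Fin n) := {r | (r : ℕ) = j ∨ (r : ℕ) + 1 = j}
    have hS : S.Nonempty := by
      rcases Nat.eq_zero_or_pos (j : ℕ) with h | h
      · exact ⟨⟨0, hn⟩, by simp [S, h]⟩
      · exact ⟨⟨j - 1, by omega⟩, by simp [S]; omega⟩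
    rcases Nat.mod_two_eq_zero_or_one j with hj | hj
    · obtain ⟨p, hp, hmin⟩ := S.exists_min_image (fun r => (σ r : ℕ)) hS
      refine ⟨σ p, p, by simpa [S] using hp, by simp, by omega, fun r hr => ⟨fun _ => ?_, by omega⟩⟩
      exact hmin r (by simpa [S] using hr)
    · obtain ⟨p, hp, hmax⟩ := S.exists_max_image (fun r => (σ r : ℕ)) hS
      refine ⟨σ p + 1, p, by simpa [S] using hp, by omega, by simp,
        fun r hr => ⟨by omega, fun _ => ?_⟩⟩
      exact Nat.lt_succ_of_le (hmax r (by simpa [S] using hr))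
  choose f hf using key
  exact ⟨f, fun {j r} hj hr => ((hf j).choose_spec.2.2.2 r hr).1 hj,
    fun {j r} hj hr => ((hf j).choose_spec.2.2.2 r hr).2 hj,
    fun j => ⟨_, (hf j).choose_spec.1, (hf j).choose_spec.2.1, (hf j).choose_spec.2.2.1⟩⟩

namespace IsCompanion

variable {n : ℕ} {σ : Perm (Fin n)} {f : Fin (n + 1) → ℕ}

theorem lt_succ (h : IsCompanion σ f) (j : Fin (n + 1)) : f j < n + 1 := by
  obtain ⟨p, -, h0, h1⟩ := h.attained j
  omega

/-- A common value gives `σ p = σ q + 1`. Between `p` and `q` lies the other neighbour of `j` or of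
`j'`, and lacing puts its entry on the side that the minimum or maximum excludes. -/
theorem ne_of_even_of_odd (h : IsCompanion σ f) (hpar : PreservesParity σ) (hl : IsLaced σ)
    {j j' : Fin (n + 1)} (hj : (j : ℕ) % 2 = 0) (hj' : (j' : ℕ) % 2 = 1) : f j ≠ f j' := by
  intro heq
  obtain ⟨p, hp, hp0, -⟩ := h.attained j
  obtain ⟨q, hq, -, hq1⟩ := h.attained j'
  have ep := hpar p
  have eq := hpar q
  have key : ∀ z, _ := fun z => hl q p z (by omega)
  rcases lt_trichotomy (p : ℕ) q with hlt | he | hlt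
  · rcases hq with hq | hq
    · have hz := h.lt hj' (r := ⟨q - 1, by omega⟩) (by simp; omega)
      have hk := key ⟨q - 1, by omega⟩
      have hne : (p : ℕ) = q - 1 → σ p = σ ⟨q - 1, by omega⟩ := fun e => congrArg σ (Fin.ext e)
      simp only [Fin.lt_def, Fin.ext_iff] at *
      omega
    · have hpz : (p : ℕ) + 1 < n := by omega
      have hz := h.le hj (r := ⟨p + 1, hpz⟩) (by simp; omega)
      have hk := key ⟨p + 1, hpz⟩
      have hne : (q : ℕ) = p + 1 → σ q = σ ⟨p + 1, hpz⟩ := fun e => congrArg σ (Fin.ext e)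
      simp only [Fin.lt_def, Fin.ext_iff] at *
      omega
  · omega
  · rcases hq with hq | hq
    · have hz := h.le hj (r := ⟨p - 1, by omega⟩) (by simp; omega)
      have hk := key ⟨p - 1, by omega⟩
      have hne : (q : ℕ) = p - 1 → σ q = σ ⟨p - 1, by omega⟩ := fun e => congrArg σ (Fin.ext e)
      simp only [Fin.lt_def, Fin.ext_iff] at *
      omega
    · have hqz : (q : ℕ) + 1 < n := by omega
      have hz := h.lt hj' (r := ⟨q + 1, hqz⟩) (by simp; omega)
      have hk := key ⟨q + 1, hqz⟩
      have hne : (p : ℕ) = q + 1 → σ p = σ ⟨q + 1, hqz⟩ := fun e => congrArg σ (Fin.ext e)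
      simp only [Fin.lt_def, Fin.ext_iff] at *
      omega

theorem injective (h : IsCompanion σ f) (hpar : PreservesParity σ) (hl : IsLaced σ) :
    Function.Injective f := by
  intro j j' heq
  obtain ⟨p, hp, hp0, hp1⟩ := h.attained j
  obtain ⟨q, hq, hq0, hq1⟩ := h.attained j'
  have hpq : (σ p : ℕ) = σ q → (p : ℕ) = q := fun e => congrArg _ (σ.injective (Fin.ext e))
  rcases Nat.mod_two_eq_zero_or_one j with hj | hj <;>
  rcases Nat.mod_two_eq_zero_or_one j' with hj' | hj'
  · omega
  · exact absurd heq (h.ne_of_even_of_odd hpar hl hj hj')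
  · exact absurd heq.symm (h.ne_of_even_of_odd hpar hl hj' hj)
  · omega

/-- The entry `i` of a companion lies on a side of the entry `i` of `σ` that the parity of `i`
determines, and the entries of `σ` between them are below `i`. -/
theorem below (h : IsCompanion σ f) (hpar : PreservesParity σ) (hl : IsLaced σ)
    {b : Fin (n + 1)} {p : Fin n} (hbp : f b = σ p) :
    ((σ p : ℕ) % 2 = 0 → (b : ℕ) ≤ p ∧ ∀ r : Fin n, (b : ℕ) ≤ r → r < p → σ r < σ p) ∧
    ((σ p : ℕ) % 2 = 1 → (p : ℕ) < b ∧ ∀ r : Fin n, p < r → (r : ℕ) < b → σ r < σ p) := by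
  obtain ⟨q, hq, hq0, hq1⟩ := h.attained b
  have hpq : (σ p : ℕ) = σ q → (p : ℕ) = q := fun e => congrArg _ (σ.injective (Fin.ext e))
  have ep := hpar p
  have eq := hpar q
  rcases Nat.mod_two_eq_zero_or_one b with hb | hb
  -- For even `b` the value is attained at `p` itself, adjacent to `b`, so nothing lies in between.
  · refine ⟨fun hp => ⟨by omega, fun r _ _ => ?_⟩, fun hp => ⟨by omega, fun r _ _ => ?_⟩⟩ <;>
    simp only [Fin.lt_def] at * <;> omega
  -- For odd `b`, `σ p = σ q + 1`; lacing of this pair gives the bound and, at the other neighbour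
  -- of `b`, the side.
  · have key : ∀ z, _ := fun z => hl q p z (by omega)
    have hr : ∀ r : Fin n, (r : ℕ) = q → σ r = σ q := fun r e => congrArg σ (Fin.ext e)
    constructor
    · intro hp
      have hbp : (b : ℕ) ≤ p := by
        by_contra! hc
        have hz := h.lt hb (r := ⟨q - 1, by omega⟩) (by simp; omega)
        have hk := key ⟨q - 1, by omega⟩
        have hne : (p : ℕ) = q - 1 → σ p = σ ⟨q - 1, by omega⟩ := fun e => congrArg σ (Fin.ext e)
        simp only [Fin.lt_def, Fin.ext_iff] at *
        omega
      refine ⟨hbp, fun r h1 h2 => ?_⟩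
      have hk := key r
      have := hr r
      simp only [Fin.lt_def, Fin.ext_iff] at *
      omega
    · intro hp
      have hbp : (p : ℕ) < b := by
        by_contra! hc
        have hqz : (q : ℕ) + 1 < n := by omega
        have hz := h.lt hb (r := ⟨q + 1, hqz⟩) (by simp; omega)
        have hk := key ⟨q + 1, hqz⟩
        have hne : (p : ℕ) = q + 1 → σ p = σ ⟨q + 1, hqz⟩ := fun e => congrArg σ (Fin.ext e)
        simp only [Fin.lt_def, Fin.ext_iff] at *
        omega
      refine ⟨hbp, fun r h1 h2 => ?_⟩
      have hk := key r
      have := hr r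
      simp only [Fin.lt_def, Fin.ext_iff] at *
      omega

/-- The entry `i + 1` of a companion lies on a side of the entry `i` of `σ` that the parity of
`i` determines, and the entries of `σ` between them are above `i`. -/
theorem above (h : IsCompanion σ f) (hpar : PreservesParity σ) (hl : IsLaced σ)
    {b : Fin (n + 1)} {p : Fin n} (hbp : f b = σ p + 1) :
    ((σ p : ℕ) % 2 = 1 → (b : ℕ) ≤ p ∧ ∀ r : Fin n, (b : ℕ) ≤ r → r < p → σ p < σ r) ∧
    ((σ p : ℕ) % 2 = 0 → (p : ℕ) < b ∧ ∀ r : Fin n, p < r → (r : ℕ) < b → σ p < σ r) := by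
  obtain ⟨q, hq, hq0, hq1⟩ := h.attained b
  have hpq : (σ p : ℕ) = σ q → (p : ℕ) = q := fun e => congrArg _ (σ.injective (Fin.ext e))
  have ep := hpar p
  have eq := hpar q
  rcases Nat.mod_two_eq_zero_or_one b with hb | hb
  · have key : ∀ z, _ := fun z => hl p q z (by omega)
    have hr : ∀ r : Fin n, (r : ℕ) = q → σ r = σ q := fun r e => congrArg σ (Fin.ext e)
    constructor
    · intro hp
      have hbp : (b : ℕ) ≤ p := by
        by_contra! hc
        have hz := h.le hb (r := ⟨q - 1, by omega⟩) (by simp; omega)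
        have hk := key ⟨q - 1, by omega⟩
        have hne : (p : ℕ) = q - 1 → σ p = σ ⟨q - 1, by omega⟩ := fun e => congrArg σ (Fin.ext e)
        simp only [Fin.lt_def, Fin.ext_iff] at *
        omega
      refine ⟨hbp, fun r h1 h2 => ?_⟩
      have hk := key r
      have := hr r
      simp only [Fin.lt_def, Fin.ext_iff] at *
      omega
    · intro hp
      have hbp : (p : ℕ) < b := by
        by_contra! hc
        have hqz : (q : ℕ) + 1 < n := by omega
        have hz := h.le hb (r := ⟨q + 1, hqz⟩) (by simp; omega)
        have hk := key ⟨q + 1, hqz⟩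
        have hne : (p : ℕ) = q + 1 → σ p = σ ⟨q + 1, hqz⟩ := fun e => congrArg σ (Fin.ext e)
        simp only [Fin.lt_def, Fin.ext_iff] at *
        omega
      refine ⟨hbp, fun r h1 h2 => ?_⟩
      have hk := key r
      have := hr r
      simp only [Fin.lt_def, Fin.ext_iff] at *
      omega
  · refine ⟨fun hp => ⟨by omega, fun r _ _ => ?_⟩, fun hp => ⟨by omega, fun r _ _ => ?_⟩⟩ <;>
    simp only [Fin.lt_def] at * <;> omega

/-- For even `t`, `f t` is at most a neighbouring entry of `σ` between `b` and `p`. For odd `t` it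
is one more than such an entry, and injectivity makes the inequality strict. -/
theorem companion_below (h : IsCompanion σ f) (hpar : PreservesParity σ) (hl : IsLaced σ)
    {b t : Fin (n + 1)} {p : Fin n} (hbp : f b = σ p)
    (ht : (b < t ∧ (t : ℕ) ≤ p) ∨ ((p : ℕ) < t ∧ t < b)) : f t < f b := by
  have hbel := h.below hpar hl hbp
  have hinj : f t = f b → (t : ℕ) = b := fun e => congrArg _ (h.injective hpar hl e)
  have ep := hpar p
  rcases Nat.mod_two_eq_zero_or_one t with h0 | h1
  · rcases Nat.mod_two_eq_zero_or_one (σ p) with hp | hp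
    · have hle := h.le h0 (r := ⟨t - 1, by omega⟩) (by simp; omega)
      have := (hbel.1 hp).2 ⟨t - 1, by omega⟩
      simp only [Fin.lt_def] at *
      omega
    · have htn : (t : ℕ) < n := by have := hbel.2 hp; omega
      have hle := h.le h0 (r := ⟨t, htn⟩) (by simp)
      have := (hbel.2 hp).2 ⟨t, htn⟩
      simp only [Fin.lt_def] at *
      omega
  · obtain ⟨q, hq, -, hq1⟩ := h.attained t
    have h2 := fun hp => (hbel.1 hp).2 q
    have h3 := fun hp => (hbel.2 hp).2 q
    simp only [Fin.lt_def] at *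
    omega

theorem companion_above (h : IsCompanion σ f) (hpar : PreservesParity σ) (hl : IsLaced σ)
    {b t : Fin (n + 1)} {p : Fin n} (hbp : f b = σ p + 1)
    (ht : (b < t ∧ (t : ℕ) ≤ p) ∨ ((p : ℕ) < t ∧ t < b)) : f b < f t := by
  have habv := h.above hpar hl hbp
  have hinj : f t = f b → (t : ℕ) = b := fun e => congrArg _ (h.injective hpar hl e)
  have ep := hpar p
  rcases Nat.mod_two_eq_zero_or_one t with h0 | h1
  · obtain ⟨q, hq, hq0, -⟩ := h.attained t
    have h2 := fun hp => (habv.1 hp).2 q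
    have h3 := fun hp => (habv.2 hp).2 q
    simp only [Fin.lt_def] at *
    omega
  · rcases Nat.mod_two_eq_zero_or_one (σ p) with hp | hp
    · have htn : (t : ℕ) < n := by have := habv.2 hp; omega
      have hle := h.lt h1 (r := ⟨t, htn⟩) (by simp)
      have := (habv.2 hp).2 ⟨t, htn⟩
      simp only [Fin.lt_def] at *
      omega
    · have hle := h.lt h1 (r := ⟨t - 1, by omega⟩) (by simp; omega)
      have := (habv.1 hp).2 ⟨t - 1, by omega⟩
      simp only [Fin.lt_def] at *
      omega

end IsCompanion

theorem isSnowLeopard_of_isLaced {n : ℕ} (hn : 0 < n) {σ : Perm (Fin n)}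
    (hpar : PreservesParity σ) (hl : IsLaced σ) : IsSnowLeopard σ := by
  obtain ⟨f, hf⟩ := exists_isCompanion hn σ
  let β : Perm (Fin (n + 1)) := Equiv.ofBijective (fun j => ⟨f j, hf.lt_succ j⟩)
    (Finite.injective_iff_bijective.1 fun i j hij =>
      hf.injective hpar hl (Fin.mk.inj_iff.1 hij))
  have hβ (j) : (β j : ℕ) = f j := rfl
  have halt : IsAlternating β := by
    intro i j hij
    have hi : (i : ℕ) < n := by omega
    -- Consecutive positions share the neighbour `i`, and `σ i` separates the minimum from the
    -- maximum plus one.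
    rw [Nat.even_iff, Nat.odd_iff, Fin.lt_def, Fin.lt_def, hβ, hβ]
    constructor
    · intro h0
      have := hf.le h0 (r := ⟨i, hi⟩) (by simp)
      have := hf.lt (j := j) (r := ⟨i, hi⟩) (by omega) (by simp; omega)
      omega
    · intro h0
      have := hf.lt h0 (r := ⟨i, hi⟩) (by simp)
      have := hf.le (j := j) (r := ⟨i, hi⟩) (by omega) (by simp; omega)
      omega
  have halt' : IsAlternating β⁻¹ := by
    intro i j hij
    obtain ⟨b, rfl⟩ := β.surjective i
    obtain ⟨c, rfl⟩ := β.surjective j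
    -- The position of the same entry in `σ` separates `b` from `c`, with sides given by its parity.
    obtain ⟨p, hp⟩ := exists_val_eq σ (i := f b) (by have := hf.lt_succ c; simp only [hβ] at *; omega)
    simp only [Perm.coe_inv, Equiv.symm_apply_apply, Nat.even_iff, Nat.odd_iff, hβ,
      Fin.lt_def] at *
    have h1 := hf.below hpar hl (b := b) hp.symm
    have h2 := hf.above hpar hl (b := c) (p := p) (by omega)
    omega
  have hbaxter : IsCompleteBaxter (interleave β σ) := by
    have hβo := (inducedOnOdd_interleave β σ).val_oddPos
    have hσe := (inducedOnEven_interleave β σ).val_evenPos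
    refine ⟨⟨n, rfl⟩, fun i => ?_, fun x y z hxy hz => ?_⟩
    · have := preservesParity_of_induced (inducedOnOdd_interleave β σ)
        (inducedOnEven_interleave β σ) i
      rw [Nat.even_iff, Nat.even_iff, this]
    · obtain ⟨a, rfl⟩ | ⟨a, rfl⟩ := exists_oddPos_or_evenPos x <;>
      obtain ⟨b, rfl⟩ | ⟨b, rfl⟩ := exists_oddPos_or_evenPos y
      · rw [hβo, hβo] at hxy
        omega
      · have hab : f a = σ b := by rw [hβo, hσe, hβ] at hxy; omega
        refine ⟨fun _ => ?_, fun ho => by rw [hβo, Nat.odd_iff] at ho; omega⟩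
        obtain ⟨c, rfl⟩ | ⟨c, rfl⟩ := exists_oddPos_or_evenPos z
        · have := hf.companion_below hpar hl (t := c) hab
          simp only [Fin.lt_def, val_oddPos, val_evenPos, hβo, hσe, hβ] at *
          omega
        · have hbel := hf.below hpar hl hab
          have h0 := fun hp => (hbel.1 hp).2 c
          have h1 := fun hp => (hbel.2 hp).2 c
          simp only [Fin.lt_def, val_oddPos, val_evenPos, hβo, hσe, hβ] at *
          omega
      · have hab : f b = σ a + 1 := by rw [hβo, hσe, hβ] at hxy; omega
        refine ⟨fun he => by rw [hσe, Nat.even_iff] at he; omega, fun _ => ?_⟩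
        obtain ⟨c, rfl⟩ | ⟨c, rfl⟩ := exists_oddPos_or_evenPos z
        · have := hf.companion_above hpar hl (t := c) hab
          simp only [Fin.lt_def, val_oddPos, val_evenPos, hβo, hσe, hβ] at *
          omega
        · have habv := hf.above hpar hl hab
          have h0 := fun hp => (habv.1 hp).2 c
          have h1 := fun hp => (habv.2 hp).2 c
          simp only [Fin.lt_def, val_oddPos, val_evenPos, hβo, hσe, hβ] at *
          omega
      · rw [hσe, hσe] at hxy
        omega
  have hodd := inducedOnOdd_interleave β σ
  have heven := inducedOnEven_interleave β σ
  exact ⟨⟨_, _, hbaxter, heven⟩, _, β, ⟨_, _, hbaxter, hodd⟩, ⟨halt, halt'⟩, _, _, hbaxter, hodd,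
    heven⟩

/-! ### Threads entangled with a monotone thread -/

theorem entangled_iff {k l : ℕ} {α : Perm (Fin k)} {β : Perm (Fin l)} :
    Entangled α β ↔ ∃ (N : ℕ) (π : Perm (Fin N)),
      Odd N ∧ IsSnowLeopard π ∧ InducedOnEven π α ∧ InducedOnOdd π β :=
  ⟨fun h => h.2.2, fun ⟨N, π, hN, hπ, hα, hβ⟩ =>
    ⟨⟨N, π, hN, hπ, hα⟩, ⟨N, π, hN, hπ, hβ⟩, N, π, hN, hπ, hα, hβ⟩⟩

theorem entangled_increasing_iff {m k : ℕ} {α : Perm (Fin k)} :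
    Entangled α (increasing (m + 1)) ↔ k = m ∧ IsInvolution α ∧ Avoids3412 α := by
  rw [← hasNestedArcs_iff, entangled_iff]
  constructor
  · rintro ⟨N, π, ⟨r, rfl⟩, hπ, hα, hβ⟩
    obtain rfl : k = r := by have := hα.1; omega
    obtain rfl : m = k := by have := hβ.1; omega
    exact ⟨rfl, hπ.preservesParity_and_isLaced.2.hasNestedArcs_of_increasing hβ hα⟩
  · rintro ⟨rfl, h⟩
    have hodd := inducedOnOdd_interleave (increasing (k + 1)) α
    have heven := inducedOnEven_interleave (increasing (k + 1)) α
    exact ⟨_, _, ⟨k, rfl⟩, isSnowLeopard_of_isLaced (by omega)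
      (preservesParity_of_induced hodd heven) (h.isLaced_increasing hodd heven), heven, hodd⟩

theorem entangled_decreasing_iff {n l : ℕ} {β : Perm (Fin l)} :
    Entangled (decreasing n) β ↔ l = n + 1 ∧ ∃ ρ : Perm (Fin l),
      IsInvolution ρ ∧ Avoids3412 ρ ∧ β = complement ρ := by
  simp_rw [← and_assoc, ← hasNestedArcs_iff, entangled_iff]
  constructor
  · rintro ⟨N, π, ⟨r, rfl⟩, hπ, hα, hβ⟩
    obtain rfl : n = r := by have := hα.1; omega
    obtain rfl : l = n + 1 := by have := hβ.1; omega
    rw [← complement_complement β] at hβ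
    exact ⟨rfl, complement β, hπ.preservesParity_and_isLaced.2.hasNestedArcs_of_decreasing hβ hα,
      (complement_complement β).symm⟩
  · rintro ⟨rfl, ρ, h, rfl⟩
    have hodd := inducedOnOdd_interleave (complement ρ) (decreasing n)
    have heven := inducedOnEven_interleave (complement ρ) (decreasing n)
    exact ⟨_, _, ⟨n, rfl⟩, isSnowLeopard_of_isLaced (by omega)
      (preservesParity_of_induced hodd heven) (h.isLaced_decreasing hodd heven), heven, hodd⟩

theorem isInvolution_one {n : ℕ} : IsInvolution (1 : Perm (Fin n)) := inv_one.symm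

theorem avoids3412_one {n : ℕ} : Avoids3412 (1 : Perm (Fin n)) := by
  rintro ⟨a, b, c, d, hab, hbc, hcd, h1, h2, h3⟩
  simp only [Perm.coe_one, id_eq] at *
  omega

end SnowLeopard

open SnowLeopard in
theorem theorem5p1 :
    (∀ n : ℕ, 1 ≤ n →
      IsOddThread (increasing n) ∧
      ∀ (k : ℕ) (α : Equiv.Perm (Fin k)),
        Entangled α (increasing n) ↔
          (k = n - 1 ∧ IsInvolution α ∧ Avoids3412 α)) ∧
    (∀ n : ℕ,
      IsEvenThread (decreasing n) ∧
      ∀ (l : ℕ) (β : Equiv.Perm (Fin l)),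
        Entangled (decreasing n) β ↔
          (l = n + 1 ∧ ∃ ρ : Equiv.Perm (Fin l),
            IsInvolution ρ ∧ Avoids3412 ρ ∧ β = complement ρ)) := by
  refine ⟨fun n hn => ?_, fun n => ⟨?_, fun l β => entangled_decreasing_iff⟩⟩
  · obtain ⟨m, rfl⟩ := Nat.exists_eq_add_of_le' hn
    refine ⟨?_, fun k α => entangled_increasing_iff⟩
    -- The identity is a 3412-avoiding involution, so some entangled partner exists and the thread
    -- property follows.
    exact (entangled_increasing_iff.2 ⟨rfl, isInvolution_one, avoids3412_one⟩).2.1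
  · exact (entangled_decreasing_iff.2 ⟨rfl, 1, isInvolution_one, avoids3412_one, rfl⟩).1
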